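/- Let $X_1, X_2, W, R$ be real, reflexive, separable Banach spaces and let $(\Omega,\mathcal F,\mathbb P)$ be a probability space. Let $C_1\subset X_1$ and $C_2\subset X_2$ be nonempty, closed and convex, let $K\subset R$ be a nonempty, closed, convex cone, and write $r\le_K s$ if $s-r\in K$. Let $J_1:X_1\to\mathbb R$ and $J_2:X_1\times X_2\to\mathbb R$ be such that $J(x_1,x_2):=J_1(x_1)+J_2(x_1,x_2)$ is convex and lower semicontinuous on $X_1\times X_2$, and such that for every $r>0$ there is $a_r>0$ with $|J_2(x_1,x_2)|\le a_r$ whenever $\|x_1\|+\|x_2\|\le r$. Let $e:X_1\times X_2\times\Omega\to W$ and $i:X_1\times X_2\times\Omega\to R$ be such that, for every $\omega$, $e(\cdot,\cdot,\omega)$ is continuous and linear and $i(\cdot,\cdot,\omega)$ is continuous and $K$-convex, i.e. $$i(\lambda p+(1-\lambda)q,\omega)\le_K\lambda\, i(p,\omega)+(1-\lambda)\,i(q,\omega)\qquad\text{for all } p,q\in X_1\times X_2,\ \lambda\in(0,1).$$ Assume that $e(x_1,x_2,\cdot)$ and $i(x_1,x_2,\cdot)$ are strongly $\mathbb P$-measurable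 for all $(x_1,x_2)$, and that for every $r>0$ there are $b_{r,e},b_{r,i}>0$ such that $\|x_1\|+\|x_2\|\le r$ implies $\|e(x_1,x_2,\omega)\|_W\le b_{r,e}$ and $\|i(x_1,x_2,\omega)\|_R\le b_{r,i}$ almost surely. Let $X:=X_1\times L^\infty(\Omega,X_2)$ and $U:=L^\infty(\Omega,W)\times L^\infty(\Omega,R)$. For $x=(x_1,x_2)\in X$ and $u=(u_e,u_i)\in U$ put $$\varphi(x,u):=J_1(x_1)+\int_\Omega J_2(x_1,x_2(\omega))\,d\mathbb P(\omega)$$ if $x_1\in C_1$ and, almost surely, $x_2(\omega)\in C_2$, $e(x_1,x_2(\omega),\omega)=u_e(\omega)$ and $i(x_1,x_2(\omega),\omega)\le_K u_i(\omega)$; otherwise put $\varphi(x,u):=\infty$. Then $\varphi:X\times U\to\mathbb R\cup\{\infty\}$ is weak$^*$ lower semicontinuous, i.e. lower semicontinuous for the coarsest topology on $X\times U$ that makes continuous all the functionals $$(x,u)\mapsto\langle x_1',x_1\rangle+\int_\Omega\langle x_2'(\omega),x_2(\omega)\rangle\,d\mathbb P(\omega)+\int_\Omega\big(\langle\lambda_e(\omega),u_e(\omega)\rangle+\langle\lambda_i(\omega),u_i(\omega)\rangle\big)\,d\mathbb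 P(\omega)$$ with $x_1'\in X_1^*$, $x_2'\in L^1(\Omega,X_2^*)$, $\lambda_e\in L^1(\Omega,W^*)$ and $\lambda_i\in L^1(\Omega,R^*)$. -/

import Mathlib

open MeasureTheory Set
open scoped ENNReal

noncomputable section

namespace TwoStage

/-- A real normed space is reflexive if the canonical map into its bidual is onto. -/
def IsReflexive (E : Type*) [NormedAddCommGroup E] [NormedSpace ℝ E] : Prop :=
  Function.Surjective (NormedSpace.inclusionInDoubleDual ℝ E)

/-- The data of the two-stage problem
`min J₁(x₁) + 𝔼[J₂(x₁, x₂(·))]` subject to `x₁ ∈ C₁` and, almost surely, `x₂(ω) ∈ C₂`,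
`e(x₁, x₂(ω), ω) = 0`, `i(x₁, x₂(ω), ω) ≤_K 0`. -/
structure Problem (Ω X₁ X₂ W R : Type*) where
  C₁ : Set X₁
  C₂ : Set X₂
  K : Set R
  J₁ : X₁ → ℝ
  J₂ : X₁ → X₂ → ℝ
  e : X₁ → X₂ → Ω → W
  i : X₁ → X₂ → Ω → R

section

variable {Ω X₁ X₂ W R : Type*} [MeasurableSpace Ω]
  [NormedAddCommGroup X₁] [NormedSpace ℝ X₁] [NormedAddCommGroup X₂] [NormedSpace ℝ X₂]
  [NormedAddCommGroup W] [NormedSpace ℝ W] [NormedAddCommGroup R] [NormedSpace ℝ R]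

/-- The order induced by the cone: `r ≤_K s` iff `s - r ∈ K`. -/
def Problem.leK (D : Problem Ω X₁ X₂ W R) (r s : R) : Prop := s - r ∈ D.K

/-- The standing assumptions on the problem. Measurability in `ω` is strong measurability with
respect to `P`. -/
structure Problem.Assumptions (D : Problem Ω X₁ X₂ W R) (P : Measure Ω) : Prop where
  C₁_nonempty : D.C₁.Nonempty
  C₁_closed : IsClosed D.C₁
  C₁_convex : Convex ℝ D.C₁
  C₂_nonempty : D.C₂.Nonempty
  C₂_closed : IsClosed D.C₂
  C₂_convex : Convex ℝ D.C₂
  K_nonempty : D.K.Nonempty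
  K_closed : IsClosed D.K
  K_convex : Convex ℝ D.K
  K_cone : ∀ c : ℝ, 0 < c → ∀ r ∈ D.K, c • r ∈ D.K
  J_convex : ConvexOn ℝ univ (fun p : X₁ × X₂ => D.J₁ p.1 + D.J₂ p.1 p.2)
  J_lsc : LowerSemicontinuous (fun p : X₁ × X₂ => D.J₁ p.1 + D.J₂ p.1 p.2)
  J₂_bound : ∀ r : ℝ, 0 < r → ∃ a : ℝ, 0 < a ∧
    ∀ x₁ x₂, ‖x₁‖ + ‖x₂‖ ≤ r → |D.J₂ x₁ x₂| ≤ a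
  e_linear : ∀ ω, IsLinearMap ℝ (fun p : X₁ × X₂ => D.e p.1 p.2 ω)
  e_continuous : ∀ ω, Continuous (fun p : X₁ × X₂ => D.e p.1 p.2 ω)
  i_convex : ∀ ω, ∀ p q : X₁ × X₂, ∀ t : ℝ, 0 < t → t < 1 →
    D.leK (D.i (t • p.1 + (1 - t) • q.1) (t • p.2 + (1 - t) • q.2) ω)
      (t • D.i p.1 p.2 ω + (1 - t) • D.i q.1 q.2 ω)
  i_continuous : ∀ ω, Continuous (fun p : X₁ × X₂ => D.i p.1 p.2 ω)
  e_measurable : ∀ x₁ x₂, AEStronglyMeasurable (fun ω => D.e x₁ x₂ ω) P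
  i_measurable : ∀ x₁ x₂, AEStronglyMeasurable (fun ω => D.i x₁ x₂ ω) P
  e_bound : ∀ r : ℝ, 0 < r → ∃ b : ℝ, 0 < b ∧
    ∀ x₁ x₂, ‖x₁‖ + ‖x₂‖ ≤ r → ∀ᵐ ω ∂P, ‖D.e x₁ x₂ ω‖ ≤ b
  i_bound : ∀ r : ℝ, 0 < r → ∃ b : ℝ, 0 < b ∧
    ∀ x₁ x₂, ‖x₁‖ + ‖x₂‖ ≤ r → ∀ᵐ ω ∂P, ‖D.i x₁ x₂ ω‖ ≤ b

/-- The objective `j(x) = J₁(x₁) + 𝔼[J₂(x₁, x₂(·))]`; see `Problem.Assumptions.integrable_J₂` for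
the integrability. -/
def Problem.j (D : Problem Ω X₁ X₂ W R) (P : Measure Ω) (x : X₁ × Lp X₂ ∞ P) : ℝ :=
  D.J₁ x.1 + ∫ ω, D.J₂ x.1 (x.2 ω) ∂P

/-- Feasibility of `x = (x₁, x₂)` for the problem perturbed by `u = (u_e, u_i)`. -/
def Problem.Feasible (D : Problem Ω X₁ X₂ W R) (P : Measure Ω)
    (x : X₁ × Lp X₂ ∞ P) (u : Lp W ∞ P × Lp R ∞ P) : Prop :=
  x.1 ∈ D.C₁ ∧ (∀ᵐ ω ∂P, x.2 ω ∈ D.C₂) ∧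
    (∀ᵐ ω ∂P, D.e x.1 (x.2 ω) ω = u.1 ω) ∧ (∀ᵐ ω ∂P, D.leK (D.i x.1 (x.2 ω) ω) (u.2 ω))

open Classical in
/-- The perturbation function `φ : X × U → ℝ ∪ {∞}`. -/
def Problem.phi (D : Problem Ω X₁ X₂ W R) (P : Measure Ω)
    (y : (X₁ × Lp X₂ ∞ P) × (Lp W ∞ P × Lp R ∞ P)) : WithTop ℝ :=
  if D.Feasible P y.1 y.2 then ((D.j P y.1 : ℝ) : WithTop ℝ) else ⊤

/-- Under the assumptions, the expectation in the objective is that of an integrable function. -/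
theorem Problem.Assumptions.integrable_J₂ {D : Problem Ω X₁ X₂ W R} {P : Measure Ω}
    [IsProbabilityMeasure P] (hD : D.Assumptions P) (x : X₁ × Lp X₂ ∞ P) :
    Integrable (fun ω => D.J₂ x.1 (x.2 ω)) P := by
  have hl : LowerSemicontinuous (fun z : X₂ => D.J₁ x.1 + D.J₂ x.1 z) :=
    hD.J_lsc.comp (g := fun z : X₂ => (x.1, z)) (by fun_prop)
  have hm : AEStronglyMeasurable (fun ω => D.J₂ x.1 (x.2 ω)) P := by
    borelize X₂
    have h1 : Measurable (fun z : X₂ => D.J₁ x.1 + D.J₂ x.1 z) := hl.measurable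
    have h2 : Measurable (fun z : X₂ => D.J₂ x.1 z) := by
      simpa using h1.sub_const (D.J₁ x.1)
    exact (h2.comp_aemeasurable (Lp.aestronglyMeasurable x.2).aemeasurable).aestronglyMeasurable
  obtain ⟨a, -, ha⟩ := hD.J₂_bound (‖x.1‖ + ‖x.2‖ + 1) (by positivity)
  refine Integrable.of_bound hm a ?_
  have hb : ∀ᵐ ω ∂P, ‖x.2 ω‖ ≤ ‖x.2‖ := by
    have := ae_le_eLpNormEssSup (f := (x.2 : Ω → X₂)) (μ := P)
    filter_upwards [this] with ω hω
    rw [Lp.norm_def, eLpNorm_exponent_top]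
    have hf : eLpNormEssSup (x.2 : Ω → X₂) P ≠ ∞ := by
      rw [← eLpNorm_exponent_top]; exact Lp.eLpNorm_ne_top x.2
    simpa using ENNReal.toReal_mono hf hω
  filter_upwards [hb] with ω hω
  exact ha _ _ (by linarith)

variable (X₁ X₂ W R) in
/-- The duality pairing of `X × U` with `X' × Λ`, where
`X × U = (X₁ × L^∞(Ω,X₂)) × (L^∞(Ω,W) × L^∞(Ω,R))` and
`X' × Λ = (X₁* × L¹(Ω,X₂*)) × (L¹(Ω,W*) × L¹(Ω,R*))`. -/
def pairing (P : Measure Ω) :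
    ((X₁ × Lp X₂ ∞ P) × (Lp W ∞ P × Lp R ∞ P)) →ₗ[ℝ]
      ((StrongDual ℝ X₁ × Lp (StrongDual ℝ X₂) 1 P) ×
        (Lp (StrongDual ℝ W) 1 P × Lp (StrongDual ℝ R) 1 P)) →ₗ[ℝ] ℝ :=
  LinearMap.mk₂ ℝ
    (fun y z =>
      z.1.1 y.1.1 +
        ContinuousLinearMap.lpPairing P ∞ 1 (NormedSpace.inclusionInDoubleDual ℝ X₂) y.1.2 z.1.2 +
        (ContinuousLinearMap.lpPairing P ∞ 1 (NormedSpace.inclusionInDoubleDual ℝ W) y.2.1 z.2.1 +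
        ContinuousLinearMap.lpPairing P ∞ 1 (NormedSpace.inclusionInDoubleDual ℝ R) y.2.2 z.2.2))
    (by intro y y' z; simp; ring) (by intro c y z; simp; ring)
    (by intro y z z'; simp; ring) (by intro c y z; simp; ring)

/-- The pairing, written with integrals. -/
theorem pairing_apply (P : Measure Ω)
    (y : (X₁ × Lp X₂ ∞ P) × (Lp W ∞ P × Lp R ∞ P))
    (z : (StrongDual ℝ X₁ × Lp (StrongDual ℝ X₂) 1 P) ×
        (Lp (StrongDual ℝ W) 1 P × Lp (StrongDual ℝ R) 1 P)) :
    pairing X₁ X₂ W R P y z =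
      z.1.1 y.1.1 + ∫ ω, z.1.2 ω (y.1.2 ω) ∂P +
        (∫ ω, z.2.1 ω (y.2.1 ω) ∂P + ∫ ω, z.2.2 ω (y.2.2 ω) ∂P) := by
  simp [pairing, ContinuousLinearMap.lpPairing_eq_integral]

variable (X₁ X₂ W R) in
/-- `X × U` with its weak* topology: the coarsest topology for which `y ↦ ⟨y, z⟩` is continuous
for every `z` in the predual `X' × Λ`. -/
abbrev WeakStarSpace (P : Measure Ω) : Type _ := WeakBilin (pairing X₁ X₂ W R P)

end

end TwoStage

end

/-! The proof shows that at each point `φ` is controlled from below by a weak* continuous affine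
function, so lower semicontinuity is checked by half-spaces. At a feasible point, the objective has
an affine minorant exact there (`exists_pairing_le_objective`). At an infeasible point, the
constraints are folded into one nonnegative convex integrand, `violation`, whose integral vanishes
exactly at feasible points. An affine minorant of that integral, exact at the given point, is
positive there and nonpositive at every feasible point, so infeasibility persists on a weak*
neighbourhood.

Both cases rest on `exists_affine_minorant`, for integrals of convex integrands bounded above near
the given point uniformly in `ω`. It integrates pointwise subgradients, which must be selected
measurably in `ω` and lie in the predual. The selection runs Hahn-Banach explicitly: directional
derivatives are lowered along a dense sequence, using only countable infima, so the resulting linear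
functionals are weak* measurable. Reflexivity and separability of `X₂`, `W`, `R` make the duals
separable, so the corresponding components are strongly measurable; being bounded, they lie in `L¹`.
-/

noncomputable section

namespace TwoStage

/-! ### Separable duals and strong measurability -/

section Separability

/-- A real normed space with separable dual is separable. -/
theorem separableSpace_of_strongDual (E : Type*) [NormedAddCommGroup E] [NormedSpace ℝ E]
    [TopologicalSpace.SeparableSpace (StrongDual ℝ E)] : TopologicalSpace.SeparableSpace E := by
  let f := TopologicalSpace.denseSeq (StrongDual ℝ E)
  have hx : ∀ n, ∃ x : E, ‖x‖ ≤ 1 ∧ ‖f n‖ / 2 ≤ ‖f n x‖ := by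
    intro n
    rcases eq_or_ne (f n) 0 with h | h
    · exact ⟨0, by simp, by simp [h]⟩
    · obtain ⟨x, hx1, hx2⟩ := (f n).exists_lt_apply_of_lt_opNorm
        (half_lt_self (norm_pos_iff.2 h))
      exact ⟨x, hx1.le, hx2.le⟩
  choose x hx1 hx2 using hx
  let M := (Submodule.span ℝ (range x)).topologicalClosure
  have hM : IsClosed (M : Set E) := Submodule.isClosed_topologicalClosure _
  have htop : (M : Set E) = univ := by
    by_contra hne
    obtain ⟨z, hz⟩ := (ne_univ_iff_exists_notMem _).1 hne
    obtain ⟨g, u, hgu, hug⟩ := geometric_hahn_banach_closed_point M.convex hM hz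
    have hu : 0 < u := by simpa using hgu 0 M.zero_mem
    have hg0 : ∀ m ∈ M, g m = 0 := by
      intro m hm
      by_contra hgm
      have := hgu ((u / g m) • m) (M.smul_mem _ hm)
      simp [hgm] at this
    have hgx : ∀ n, g (x n) = 0 := fun n =>
      hg0 _ (Submodule.le_topologicalClosure _ (Submodule.subset_span (mem_range_self n)))
    have hgpos : 0 < ‖g‖ := by
      rw [norm_pos_iff]
      rintro rfl
      simp at hug
      linarith
    -- Since `g` kills `x n`, `‖f n‖ / 2 ≤ ‖g - f n‖ < ‖g‖ / 3`; yet `‖f n‖ > 2‖g‖ / 3`, a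
    -- contradiction.
    obtain ⟨n, hn⟩ := (TopologicalSpace.denseRange_denseSeq (StrongDual ℝ E)).exists_dist_lt g
      (show 0 < ‖g‖ / 3 by positivity)
    rw [dist_eq_norm] at hn
    change ‖g - f n‖ < _ at hn
    have h1 : ‖f n (x n)‖ ≤ ‖g - f n‖ := by
      have : f n (x n) = -((g - f n) (x n)) := by simp [hgx]
      rw [this, norm_neg]
      exact (ContinuousLinearMap.le_opNorm _ _).trans
        (mul_le_of_le_one_right (norm_nonneg _) (hx1 n))
    have h2 : ‖g‖ ≤ ‖g - f n‖ + ‖f n‖ := by simpa using norm_add_le (g - f n) (f n)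
    linarith [hx2 n]
  rw [← TopologicalSpace.isSeparable_univ_iff, ← htop]
  exact ((countable_range x).isSeparable.span (R := ℝ)).closure

/-- The bidual is a continuous image of `E`, hence separable, and separability descends from the
bidual to the dual. -/
theorem IsReflexive.separableSpace_strongDual {E : Type*} [NormedAddCommGroup E]
    [NormedSpace ℝ E] [TopologicalSpace.SeparableSpace E] (hE : IsReflexive E) :
    TopologicalSpace.SeparableSpace (StrongDual ℝ E) := by
  have : TopologicalSpace.SeparableSpace (StrongDual ℝ (StrongDual ℝ E)) :=
    hE.denseRange.separableSpace (NormedSpace.inclusionInDoubleDual ℝ E).continuous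
  exact separableSpace_of_strongDual _

/-- A weak-star measurable map into a separable dual space is strongly measurable. -/
theorem aestronglyMeasurable_strongDual {Ω E : Type*} [MeasurableSpace Ω] {P : Measure Ω}
    [NormedAddCommGroup E] [NormedSpace ℝ E] [TopologicalSpace.SeparableSpace E]
    [TopologicalSpace.SeparableSpace (StrongDual ℝ E)] {a : Ω → StrongDual ℝ E}
    (ha : ∀ v, AEMeasurable (fun ω => a ω v) P) : AEStronglyMeasurable a P := by
  borelize (StrongDual ℝ E)
  have : PolishSpace (StrongDual ℝ E) := by
    have := UniformSpace.secondCountable_of_separable (StrongDual ℝ E)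
    infer_instance
  have : SecondCountableTopology (StrongDual ℝ E) :=
    UniformSpace.secondCountable_of_separable (StrongDual ℝ E)
  let d := TopologicalSpace.denseSeq E
  let T : StrongDual ℝ E → ℕ → ℝ := fun f n => f (d n)
  -- By Lusin-Souslin, a continuous injection of a Polish space is a measurable embedding, so
  -- evaluations at a dense sequence detect Borel measurability in the norm topology.
  have hT : MeasurableEmbedding T := by
    refine Continuous.measurableEmbedding (by fun_prop) fun f g hfg => ?_
    exact DFunLike.coe_injective ((TopologicalSpace.denseRange_denseSeq E).equalizer
      f.continuous g.continuous hfg)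
  refine AEMeasurable.aestronglyMeasurable (hT.aemeasurable_comp_iff.1 ?_)
  exact aemeasurable_pi_iff.2 fun n => ha (d n)

end Separability

/-! ### A measurable Hahn-Banach theorem -/

section HahnBanach

variable {E : Type*} [NormedAddCommGroup E]

/-- Subadditive functions which are homogeneous over `ℕ` and bounded by `L * ‖·‖`. -/
structure IsSublinearBound (L : ℝ) (s : E → ℝ) : Prop where
  add_le : ∀ x y, s (x + y) ≤ s x + s y
  le_nsmul : ∀ (k : ℕ) x, k * s x ≤ s (k • x)
  le_norm : ∀ x, s x ≤ L * ‖x‖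

namespace IsSublinearBound

variable {L : ℝ} {s : E → ℝ}

theorem map_zero (hs : IsSublinearBound L s) : s 0 = 0 := by
  have h1 := hs.add_le 0 0
  have h2 := hs.le_norm 0
  simp only [add_zero, norm_zero, mul_zero] at h1 h2
  linarith

theorem neg_le (hs : IsSublinearBound L s) (x : E) : -s (-x) ≤ s x := by
  have := hs.add_le x (-x)
  rw [add_neg_cancel, hs.map_zero] at this
  linarith

theorem neg_norm_le (hs : IsSublinearBound L s) (x : E) : -(L * ‖x‖) ≤ s x := by
  have h1 := hs.neg_le x
  have h2 := hs.le_norm (-x)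
  rw [norm_neg] at h2
  linarith

theorem map_nsmul (hs : IsSublinearBound L s) (k : ℕ) (x : E) : s (k • x) = k * s x := by
  refine le_antisymm ?_ (hs.le_nsmul k x)
  induction k with
  | zero => simp [hs.map_zero]
  | succ k ih =>
    rw [succ_nsmul]
    push_cast
    linarith [hs.add_le (k • x) x]

end IsSublinearBound

/-- The Hahn-Banach step: lower `s` to a function which is linear along `d`. -/
def extendStep (s : E → ℝ) (d x : E) : ℝ := ⨅ n : ℕ, (s (x + n • d) - n * s d)

section

variable {L : ℝ} {s : E → ℝ} (hs : IsSublinearBound L s) (d : E)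
include hs

/-- Bounds the terms below, so that the real infimum in `extendStep` is a genuine one. -/
theorem IsSublinearBound.neg_le_extendStep_term (x : E) (n : ℕ) :
    -s (-x) ≤ s (x + n • d) - n * s d := by
  have h1 := hs.add_le (x + n • d) (-x)
  rw [add_neg_cancel_comm, hs.map_nsmul] at h1
  linarith

theorem IsSublinearBound.extendStep_le_term (x : E) (n : ℕ) :
    extendStep s d x ≤ s (x + n • d) - n * s d :=
  ciInf_le ⟨-s (-x), forall_mem_range.2 (hs.neg_le_extendStep_term d x)⟩ n

theorem IsSublinearBound.extendStep_le (x : E) : extendStep s d x ≤ s x := by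
  simpa using hs.extendStep_le_term d x 0

/-- The term `n = 1` at `-d` is `s 0 - s d`. This is the inequality that later forces oddness along
`d`. -/
theorem IsSublinearBound.extendStep_neg_le : extendStep s d (-d) ≤ -s d := by
  have := hs.extendStep_le_term d (-d) 1
  simpa [hs.map_zero] using this

theorem IsSublinearBound.extendStep : IsSublinearBound L (extendStep s d) where
  add_le x y := by
    refine le_ciInf_add_ciInf fun n m => ?_
    refine (hs.extendStep_le_term d (x + y) (n + m)).trans ?_
    have h := hs.add_le (x + n • d) (y + m • d)
    have : x + y + (n + m) • d = x + n • d + (y + m • d) := by rw [add_smul]; abel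
    rw [this]
    push_cast
    linarith
  le_nsmul k x := by
    refine le_ciInf fun n => ?_
    rcases Nat.eq_zero_or_pos k with rfl | hk
    · have := hs.neg_le_extendStep_term d 0 n
      simpa [hs.map_zero] using this
    obtain ⟨j, rfl⟩ : ∃ j, k = j + 1 := ⟨k - 1, by omega⟩
    have h1 := hs.extendStep_le_term d x n
    have h2 := hs.map_nsmul (j + 1) (x + n • d)
    -- Splitting `(j + 1) • (x + n • d)` leaves a surplus `(j * n) • d`, whose cost `j * n * s d` is
    -- exactly the difference between the subtracted terms.
    have h3 := hs.add_le ((j + 1) • x + n • d) ((j * n) • d)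
    rw [hs.map_nsmul] at h3
    have : (j + 1) • (x + n • d) = (j + 1) • x + n • d + (j * n) • d := by
      simp only [smul_add, smul_smul, add_assoc, ← add_smul]
      congr 2
      ring
    rw [this] at h2
    have h4 := mul_le_mul_of_nonneg_left h1 (Nat.cast_nonneg (α := ℝ) (j + 1))
    push_cast at *
    linarith
  le_norm x := (hs.extendStep_le d x).trans (hs.le_norm x)

end

/-- The iterated Hahn-Banach step along a sequence of directions. -/
def extendIter (s : E → ℝ) (d : ℕ → E) : ℕ → E → ℝ
  | 0 => s
  | k + 1 => extendStep (extendIter s d k) (d k)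

theorem IsSublinearBound.extendIter {L : ℝ} {s : E → ℝ} (hs : IsSublinearBound L s)
    (d : ℕ → E) (k : ℕ) : IsSublinearBound L (extendIter s d k) := by
  induction k with
  | zero => exact hs
  | succ k ih => exact ih.extendStep (d k)

variable [NormedSpace ℝ E]

/-- A sublinear functional dominates the linear functional obtained as the limit of the
Hahn-Banach steps along a dense sequence. -/
theorem IsSublinearBound.exists_strongDual {L : ℝ} {s : E → ℝ} (hs : IsSublinearBound L s)
    {d : ℕ → E} (hd : DenseRange d) :
    ∃ a : StrongDual ℝ E, (∀ x, a x = ⨅ k, TwoStage.extendIter s d k x) ∧ (∀ x, a x ≤ s x) ∧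
      ∀ x, ‖a x‖ ≤ L * ‖x‖ := by
  let f : ℕ → E → ℝ := TwoStage.extendIter s d
  let S : E → ℝ := fun x => ⨅ k, f k x
  have hf : ∀ k, IsSublinearBound L (f k) := hs.extendIter d
  have hanti : ∀ x, Antitone fun k => f k x := fun x =>
    antitone_nat_of_succ_le fun k => (hf k).extendStep_le (d k) x
  have hSle : ∀ k x, S x ≤ f k x := fun k x =>
    ciInf_le ⟨-(L * ‖x‖), forall_mem_range.2 fun k => (hf k).neg_norm_le x⟩ k
  have hS : IsSublinearBound L S :=
    { add_le := fun x y => by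
        refine le_ciInf_add_ciInf fun j k => ?_
        exact (hSle (max j k) _).trans (((hf _).add_le x y).trans
          (add_le_add (hanti x (le_max_left j k)) (hanti y (le_max_right j k))))
      le_nsmul := fun k x => le_ciInf fun j =>
        (mul_le_mul_of_nonneg_left (hSle j x) (Nat.cast_nonneg k)).trans ((hf j).le_nsmul k x)
      le_norm := fun x => (hSle 0 x).trans ((hf 0).le_norm x) }
  have hlip : ∀ x y, S x - S y ≤ L * ‖x - y‖ := fun x y => by
    have := hS.add_le (x - y) y
    rw [sub_add_cancel] at this
    linarith [hS.le_norm (x - y)]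
  have hcont : Continuous S := by
    refine (LipschitzWith.of_dist_le' (K := L) fun x y => ?_).continuous
    rw [dist_eq_norm, dist_eq_norm, Real.norm_eq_abs, abs_sub_le_iff]
    exact ⟨hlip x y, norm_sub_rev y x ▸ hlip y x⟩
  have hodd : ∀ x, S (-x) = -S x := by
    -- Step `k + 1` makes the limit odd at `d k`; density and the Lipschitz bound extend this to all
    -- of `E`. A subadditive odd function is additive.
    have h : (fun x => S (-x)) = fun x => -S x := by
      refine Continuous.ext_on hd (by fun_prop) (by fun_prop) (forall_mem_range.2 fun k => ?_)
      refine le_antisymm ?_ ?_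
      · have h1 : f (k + 1) (-d k) ≤ -f k (d k) := (hf k).extendStep_neg_le (d k)
        exact (hSle (k + 1) _).trans (h1.trans (neg_le_neg (hSle k _)))
      · linarith [hS.neg_le (d k)]
    exact congrFun h
  have hadd : ∀ x y, S (x + y) = S x + S y := fun x y => by
    refine le_antisymm (hS.add_le x y) ?_
    have := hS.add_le (x + y) (-y)
    rw [add_neg_cancel_right, hodd] at this
    linarith
  -- A continuous additive map is real-linear, so homogeneity over `ℕ` was enough.
  refine ⟨(AddMonoidHom.mk' S hadd).toRealLinearMap hcont, fun x => rfl, fun x => hSle 0 x,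
    fun x => ?_⟩
  exact abs_le.2 ⟨hS.neg_norm_le x, hS.le_norm x⟩

/-- A measurable family of sublinear functionals dominates a measurable family of linear
functionals. -/
theorem exists_measurable_strongDual_le {Ω : Type*} [MeasurableSpace Ω] {P : Measure Ω}
    [TopologicalSpace.SeparableSpace E] {L : ℝ} {s : Ω → E → ℝ}
    (hm : ∀ x, AEMeasurable (fun ω => s ω x) P) (hs : ∀ᵐ ω ∂P, IsSublinearBound L (s ω)) :
    ∃ a : Ω → StrongDual ℝ E, (∀ x, AEMeasurable (fun ω => a ω x) P) ∧
      ∀ᵐ ω ∂P, (∀ x, a ω x ≤ s ω x) ∧ ∀ x, ‖a ω x‖ ≤ L * ‖x‖ := by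
  let d := TopologicalSpace.denseSeq E
  have hd : DenseRange d := TopologicalSpace.denseRange_denseSeq E
  have hiter : ∀ k x, AEMeasurable (fun ω => extendIter (s ω) d k x) P := by
    intro k
    induction k with
    | zero => exact hm
    | succ k ih =>
      exact fun x => AEMeasurable.iInf fun n => (ih _).sub ((ih _).const_mul _)
  have hex : ∀ ω, ∃ a : StrongDual ℝ E, IsSublinearBound L (s ω) →
      (∀ x, a x = ⨅ k, extendIter (s ω) d k x) ∧ (∀ x, a x ≤ s ω x) ∧
        ∀ x, ‖a x‖ ≤ L * ‖x‖ := by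
    intro ω
    by_cases h : IsSublinearBound L (s ω)
    · obtain ⟨a, ha⟩ := h.exists_strongDual hd
      exact ⟨a, fun _ => ha⟩
    · exact ⟨0, fun h' => absurd h' h⟩
  choose a ha using hex
  refine ⟨a, fun x => ?_, hs.mono fun ω hω => (ha ω hω).2⟩
  -- The explicit formula makes the chosen functional measurable; its values on the exceptional null
  -- set are irrelevant.
  exact (AEMeasurable.iInf fun k => hiter k x).congr
    (hs.mono fun ω hω => ((ha ω hω).1 x).symm)

end HahnBanach

/-! ### Measurable subgradients -/

section Subgradient

variable {E : Type*} [NormedAddCommGroup E] [NormedSpace ℝ E]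

/-- The directional derivative of a convex function, as an infimum of difference quotients. -/
def dirDeriv (g : E → ℝ) (p d : E) : ℝ :=
  ⨅ n : ℕ, ((n : ℝ) + 1) * (g (p + ((n : ℝ) + 1)⁻¹ • d) - g p)

section

variable {g : E → ℝ} (hg : ConvexOn ℝ univ g) (p : E)
include hg

/-- Convexity along a segment issuing from `p`. -/
theorem _root_.ConvexOn.sub_le_mul_sub {t : ℝ} (h0 : 0 ≤ t) (h1 : t ≤ 1) (d : E) :
    g (p + t • d) - g p ≤ t * (g (p + d) - g p) := by
  have h := hg.2 (mem_univ (p + d)) (mem_univ p) h0 (sub_nonneg.2 h1) (by ring)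
  have : t • (p + d) + (1 - t) • p = p + t • d := by module
  rw [this, smul_eq_mul, smul_eq_mul] at h
  linarith

/-- The point `p` is a convex combination of `p - d` and `p + d / (n + 1)`. Hence the infimum in
`dirDeriv` is bounded below. -/
theorem neg_le_dirDeriv_term (d : E) (n : ℕ) :
    -(g (p - d) - g p) ≤ ((n : ℝ) + 1) * (g (p + ((n : ℝ) + 1)⁻¹ • d) - g p) := by
  have hn : (0 : ℝ) < (n : ℝ) + 1 := by positivity
  have h := hg.2 (mem_univ (p + ((n : ℝ) + 1)⁻¹ • d)) (mem_univ (p - d))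
    (show 0 ≤ ((n : ℝ) + 1) / (n + 2) by positivity) (show 0 ≤ 1 / ((n : ℝ) + 2) by positivity)
    (by field_simp; ring)
  have : (((n : ℝ) + 1) / (n + 2)) • (p + ((n : ℝ) + 1)⁻¹ • d) + ((1 : ℝ) / (n + 2)) • (p - d)
      = p := by
    match_scalars <;> field_simp <;> ring
  rw [this, smul_eq_mul, smul_eq_mul] at h
  field_simp at h
  rw [one_div] at h
  linarith

theorem dirDeriv_le_term (d : E) (n : ℕ) :
    dirDeriv g p d ≤ ((n : ℝ) + 1) * (g (p + ((n : ℝ) + 1)⁻¹ • d) - g p) :=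
  ciInf_le ⟨_, forall_mem_range.2 (neg_le_dirDeriv_term hg p d)⟩ n

theorem dirDeriv_le (d : E) : dirDeriv g p d ≤ g (p + d) - g p := by
  simpa using dirDeriv_le_term hg p d 0

/-- An increase of at most `M` over the ball of radius `δ` gives slope at most `M / δ`, by convexity
along rays. -/
theorem isSublinearBound_dirDeriv {M δ : ℝ} (hδ : 0 < δ)
    (hM : ∀ d, ‖d‖ ≤ δ → g (p + d) - g p ≤ M) : IsSublinearBound (M / δ) (dirDeriv g p) where
  add_le x y := by
    refine le_ciInf_add_ciInf fun n m => ?_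
    -- This index has step `1 / (n + m + 2)`, and `p + (x + y) / (n + m + 2)` is a convex
    -- combination of `p + x / (n + 1)` and `p + y / (m + 1)`.
    refine (dirDeriv_le_term hg p (x + y) (n + m + 1)).trans ?_
    have hn : (0 : ℝ) < (n : ℝ) + 1 := by positivity
    have hm : (0 : ℝ) < (m : ℝ) + 1 := by positivity
    have h := hg.2 (mem_univ (p + ((n : ℝ) + 1)⁻¹ • x)) (mem_univ (p + ((m : ℝ) + 1)⁻¹ • y))
      (show 0 ≤ ((n : ℝ) + 1) / (n + m + 2) by positivity)
      (show 0 ≤ ((m : ℝ) + 1) / (n + m + 2) by positivity) (by field_simp; ring)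
    have : (((n : ℝ) + 1) / (n + m + 2)) • (p + ((n : ℝ) + 1)⁻¹ • x) +
        (((m : ℝ) + 1) / (n + m + 2)) • (p + ((m : ℝ) + 1)⁻¹ • y)
        = p + (((n + m + 1 : ℕ) : ℝ) + 1)⁻¹ • (x + y) := by
      push_cast
      match_scalars <;> field_simp <;> ring
    rw [this, smul_eq_mul, smul_eq_mul] at h
    have h2 := mul_le_mul_of_nonneg_left h (show (0 : ℝ) ≤ n + m + 2 by positivity)
    have h3 : ∀ A B : ℝ, ((n : ℝ) + m + 2) * ((n + 1) / (n + m + 2) * A + (m + 1) / (n + m + 2) * B)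
        = (n + 1) * A + (m + 1) * B := fun A B => by field_simp
    rw [h3] at h2
    push_cast at h2 ⊢
    linarith
  le_nsmul k x := by
    refine le_ciInf fun n => ?_
    rcases Nat.eq_zero_or_pos k with rfl | hk
    · simp
    have hk' : (1 : ℝ) ≤ k := by exact_mod_cast hk
    have h1 := dirDeriv_le_term hg p x n
    have h2 := hg.sub_le_mul_sub p (t := (k : ℝ)⁻¹) (by positivity) (inv_le_one_of_one_le₀ hk')
      (((n : ℝ) + 1)⁻¹ • (k • x))
    have : (k : ℝ)⁻¹ • ((n : ℝ) + 1)⁻¹ • k • x = ((n : ℝ) + 1)⁻¹ • x := by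
      rw [← Nat.cast_smul_eq_nsmul ℝ, smul_comm, inv_smul_smul₀ (by positivity)]
    rw [this] at h2
    calc (k : ℝ) * dirDeriv g p x
        ≤ k * (((n : ℝ) + 1) * ((k : ℝ)⁻¹ * (g (p + ((n : ℝ) + 1)⁻¹ • k • x) - g p))) := by
          refine mul_le_mul_of_nonneg_left (h1.trans ?_) (by positivity)
          exact mul_le_mul_of_nonneg_left h2 (by positivity)
      _ = _ := by field_simp
  le_norm x := by
    rcases eq_or_ne x 0 with rfl | hx
    · simp [dirDeriv]
    have hx : 0 < ‖x‖ := norm_pos_iff.2 hx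
    -- With this `n`, the point `p + x / (n + 1)` lies between `p` and the point at distance `δ` in
    -- direction `x`.
    obtain ⟨n, hn⟩ := exists_nat_ge (‖x‖ / δ)
    have hn' : ‖x‖ ≤ (n + 1) * δ := by
      rw [div_le_iff₀ hδ] at hn
      linarith
    have h1 := dirDeriv_le_term hg p x n
    have h2 := hg.sub_le_mul_sub p (t := ‖x‖ / ((n + 1) * δ)) (by positivity)
      (div_le_one_of_le₀ hn' (by positivity)) ((δ / ‖x‖) • x)
    have h3 : (‖x‖ / ((n + 1) * δ)) • (δ / ‖x‖) • x = ((n : ℝ) + 1)⁻¹ • x := by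
      rw [smul_smul]
      congr 1
      field_simp
    rw [h3] at h2
    have h4 := hM ((δ / ‖x‖) • x) (by
      rw [norm_smul, Real.norm_of_nonneg (by positivity), div_mul_cancel₀ _ hx.ne'])
    calc dirDeriv g p x ≤ (n + 1) * (‖x‖ / ((n + 1) * δ) * M) :=
          h1.trans (mul_le_mul_of_nonneg_left
            (h2.trans (mul_le_mul_of_nonneg_left h4 (by positivity))) (by positivity))
      _ = M / δ * ‖x‖ := by field_simp

end

/-- Measurable selection of subgradients of a convex integrand along a measurable map. -/
theorem exists_measurable_subgradient {Ω : Type*} [MeasurableSpace Ω] {P : Measure Ω}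
    [TopologicalSpace.SeparableSpace E] {g : Ω → E → ℝ} {p : Ω → E}
    (hg : ∀ ω, ConvexOn ℝ univ (g ω)) (hm : ∀ d, AEMeasurable (fun ω => g ω (p ω + d)) P)
    {M δ : ℝ} (hδ : 0 < δ) (hM : ∀ᵐ ω ∂P, ∀ d, ‖d‖ ≤ δ → g ω (p ω + d) - g ω (p ω) ≤ M) :
    ∃ a : Ω → StrongDual ℝ E, (∀ x, AEMeasurable (fun ω => a ω x) P) ∧
      ∀ᵐ ω ∂P, (∀ q, g ω (p ω) + a ω (q - p ω) ≤ g ω q) ∧ ∀ x, ‖a ω x‖ ≤ M / δ * ‖x‖ := by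
  have hm0 : AEMeasurable (fun ω => g ω (p ω)) P := by simpa using hm 0
  obtain ⟨a, ha, hle⟩ := exists_measurable_strongDual_le (P := P) (L := M / δ)
    (s := fun ω => dirDeriv (g ω) (p ω))
    (fun x => AEMeasurable.iInf fun n => ((hm _).sub hm0).const_mul _)
    (hM.mono fun ω hω => isSublinearBound_dirDeriv (hg ω) (p ω) hδ hω)
  refine ⟨a, ha, hle.mono fun ω hω => ⟨fun q => ?_, hω.2⟩⟩
  have h := (hω.1 (q - p ω)).trans (dirDeriv_le (hg ω) (p ω) (q - p ω))
  rw [add_sub_cancel] at h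
  linarith

end Subgradient

/-! ### Weak* continuous affine minorants -/

section Minorant

/-- A bounded random functional, composed with a contraction, is represented in the predual. -/
theorem exists_lpPairing_eq_integral {Ω E F : Type*} [MeasurableSpace Ω] {P : Measure Ω}
    [IsFiniteMeasure P] [NormedAddCommGroup E] [NormedSpace ℝ E] [NormedAddCommGroup F]
    [NormedSpace ℝ F] [TopologicalSpace.SeparableSpace E] (hE : IsReflexive E)
    {a : Ω → StrongDual ℝ F} (ha : ∀ x, AEMeasurable (fun ω => a ω x) P) {C : ℝ} (hC0 : 0 ≤ C)
    (hC : ∀ᵐ ω ∂P, ∀ x, ‖a ω x‖ ≤ C * ‖x‖) (T : E →L[ℝ] F) (hT : ∀ v, ‖T v‖ ≤ ‖v‖) :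
    ∃ z : Lp (StrongDual ℝ E) 1 P, ∀ f : Lp E ∞ P, Integrable (fun ω => a ω (T (f ω))) P ∧
      ContinuousLinearMap.lpPairing P ∞ 1 (NormedSpace.inclusionInDoubleDual ℝ E) f z =
        ∫ ω, a ω (T (f ω)) ∂P := by
  have := hE.separableSpace_strongDual
  have hb1 : MemLp (fun ω => a ω ∘L T) 1 P := by
    refine MemLp.of_bound (aestronglyMeasurable_strongDual fun v => ha (T v)) C ?_
    filter_upwards [hC] with ω hω
    exact ContinuousLinearMap.opNorm_le_bound _ hC0 fun v =>
      (hω (T v)).trans (mul_le_mul_of_nonneg_left (hT v) hC0)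
  refine ⟨hb1.toLp _, fun f => ⟨memLp_one_iff_integrable.1 <|
    (NormedSpace.inclusionInDoubleDual ℝ E).memLp_of_bilin (r := 1) (Lp.memLp f) hb1, ?_⟩⟩
  rw [ContinuousLinearMap.lpPairing_eq_integral]
  refine integral_congr_ae ?_
  filter_upwards [hb1.coeFn_toLp] with ω hω
  rw [hω, NormedSpace.dual_def, ContinuousLinearMap.comp_apply]

variable {Ω X₁ X₂ W R : Type*} [MeasurableSpace Ω]
  [NormedAddCommGroup X₁] [NormedSpace ℝ X₁] [NormedAddCommGroup X₂] [NormedSpace ℝ X₂]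
  [NormedAddCommGroup W] [NormedSpace ℝ W] [NormedAddCommGroup R] [NormedSpace ℝ R]

/-- The values of a decision and a perturbation at `ω`. -/
def valueAt {P : Measure Ω} (y : (X₁ × Lp X₂ ∞ P) × (Lp W ∞ P × Lp R ∞ P)) (ω : Ω) :
    X₁ × X₂ × W × R := (y.1.1, y.1.2 ω, y.2.1 ω, y.2.2 ω)

/-- A bounded random functional induces a weak-star continuous functional. -/
theorem exists_pairing_eq_integral {P : Measure Ω} [IsProbabilityMeasure P]
    [TopologicalSpace.SeparableSpace X₂] (hX₂ : IsReflexive X₂)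
    [TopologicalSpace.SeparableSpace W] (hW : IsReflexive W)
    [TopologicalSpace.SeparableSpace R] (hR : IsReflexive R)
    {a : Ω → StrongDual ℝ (X₁ × X₂ × W × R)} (ha : ∀ x, AEMeasurable (fun ω => a ω x) P)
    {C : ℝ} (hC0 : 0 ≤ C) (hC : ∀ᵐ ω ∂P, ∀ x, ‖a ω x‖ ≤ C * ‖x‖) :
    ∃ z, ∀ y, Integrable (fun ω => a ω (valueAt y ω)) P ∧
      pairing X₁ X₂ W R P y z = ∫ ω, a ω (valueAt y ω) ∂P := by
  obtain ⟨z₂, h₂⟩ := exists_lpPairing_eq_integral hX₂ ha hC0 hC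
    (ContinuousLinearMap.inr ℝ X₁ (X₂ × W × R) ∘L ContinuousLinearMap.inl ℝ X₂ (W × R))
    (by simp [Prod.norm_def])
  obtain ⟨z₃, h₃⟩ := exists_lpPairing_eq_integral hW ha hC0 hC
    (ContinuousLinearMap.inr ℝ X₁ (X₂ × W × R) ∘L ContinuousLinearMap.inr ℝ X₂ (W × R) ∘L
      ContinuousLinearMap.inl ℝ W R) (by simp [Prod.norm_def])
  obtain ⟨z₄, h₄⟩ := exists_lpPairing_eq_integral hR ha hC0 hC
    (ContinuousLinearMap.inr ℝ X₁ (X₂ × W × R) ∘L ContinuousLinearMap.inr ℝ X₂ (W × R) ∘L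
      ContinuousLinearMap.inr ℝ W R) (by simp [Prod.norm_def])
  have hint : ∀ v : X₁, Integrable (fun ω => a ω (v, 0)) P := fun v =>
    Integrable.of_bound (ha _).aestronglyMeasurable (C * ‖((v, 0) : X₁ × X₂ × W × R)‖)
      (hC.mono fun ω hω => hω _)
  -- The first-stage decision does not depend on `ω`, so its component of the functional is averaged
  -- into one element of the dual of `X₁`.
  let α : X₁ →ₗ[ℝ] ℝ :=
    { toFun := fun v => ∫ ω, a ω (v, 0) ∂P
      map_add' := fun v w => by
        rw [← integral_add (hint v) (hint w)]
        refine integral_congr_ae (ae_of_all _ fun ω => ?_)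
        simp only [← map_add, Prod.mk_add_mk, add_zero]
      map_smul' := fun c v => by
        rw [RingHom.id_apply, ← integral_smul]
        refine integral_congr_ae (ae_of_all _ fun ω => ?_)
        simp only [← map_smul, Prod.smul_mk, smul_zero] }
  let α' : StrongDual ℝ X₁ := α.mkContinuous C fun v => by
    have := norm_integral_le_of_norm_le_const (hC.mono fun ω hω => hω (v, 0))
    simpa [Prod.norm_def, α] using this
  refine ⟨((α', z₂), (z₃, z₄)), fun y => ?_⟩
  have hsum : (fun ω => a ω (valueAt y ω)) = fun ω => (a ω (y.1.1, 0) +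
      a ω (0, y.1.2 ω, 0)) + (a ω (0, 0, y.2.1 ω, 0) + a ω (0, 0, 0, y.2.2 ω)) := by
    funext ω
    simp only [← map_add]
    simp [valueAt]
  have i₂ := (h₂ y.1.2).1
  have i₃ := (h₃ y.2.1).1
  have i₄ := (h₄ y.2.2).1
  simp only [ContinuousLinearMap.comp_apply, ContinuousLinearMap.inr_apply,
    ContinuousLinearMap.inl_apply] at i₂ i₃ i₄
  have i₁₂ : Integrable (fun ω => a ω (y.1.1, 0) + a ω (0, y.1.2 ω, 0)) P := (hint _).add i₂
  have i₃₄ : Integrable (fun ω => a ω (0, 0, y.2.1 ω, 0) + a ω (0, 0, 0, y.2.2 ω)) P := i₃.add i₄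
  refine ⟨hsum ▸ i₁₂.add i₃₄, ?_⟩
  rw [hsum, integral_add i₁₂ i₃₄, integral_add (hint _) i₂, integral_add i₃ i₄]
  simp only [pairing, LinearMap.mk₂_apply, (h₂ y.1.2).2, (h₃ y.2.1).2, (h₄ y.2.2).2]
  rfl

/-- An integral functional with convex integrand which is bounded above near `y₀` has a weak-star
continuous affine minorant which is exact at `y₀`. -/
theorem exists_affine_minorant {P : Measure Ω} [IsProbabilityMeasure P]
    [TopologicalSpace.SeparableSpace X₁]
    [TopologicalSpace.SeparableSpace X₂] (hX₂ : IsReflexive X₂)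
    [TopologicalSpace.SeparableSpace W] (hW : IsReflexive W)
    [TopologicalSpace.SeparableSpace R] (hR : IsReflexive R)
    {g : Ω → X₁ × X₂ × W × R → ℝ} (hg : ∀ ω, ConvexOn ℝ univ (g ω))
    (y₀ : (X₁ × Lp X₂ ∞ P) × (Lp W ∞ P × Lp R ∞ P))
    (hm : ∀ d, AEMeasurable (fun ω => g ω (valueAt y₀ ω + d)) P)
    {M δ : ℝ} (hδ : 0 < δ)
    (hM : ∀ᵐ ω ∂P, ∀ d, ‖d‖ ≤ δ → g ω (valueAt y₀ ω + d) - g ω (valueAt y₀ ω) ≤ M)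
    (hint : ∀ y : (X₁ × Lp X₂ ∞ P) × (Lp W ∞ P × Lp R ∞ P),
      Integrable (fun ω => g ω (valueAt y ω)) P) :
    ∃ z, ∃ c : ℝ, pairing X₁ X₂ W R P y₀ z + c = ∫ ω, g ω (valueAt y₀ ω) ∂P ∧
      ∀ y, pairing X₁ X₂ W R P y z + c ≤ ∫ ω, g ω (valueAt y ω) ∂P := by
  obtain ⟨a, ha, hsub⟩ := exists_measurable_subgradient hg hm hδ hM
  have hC0 : 0 ≤ M / δ := by
    obtain ⟨ω, hω⟩ := hM.exists
    have : 0 ≤ M := by simpa using hω 0 (by simpa using hδ.le)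
    positivity
  obtain ⟨z, hz⟩ := exists_pairing_eq_integral hX₂ hW hR ha hC0 (hsub.mono fun ω hω => hω.2)
  refine ⟨z, ∫ ω, g ω (valueAt y₀ ω) ∂P - pairing X₁ X₂ W R P y₀ z, by ring, fun y => ?_⟩
  have hadd : Integrable (fun ω => g ω (valueAt y₀ ω) + a ω (valueAt y ω)) P :=
    (hint y₀).add (hz y).1
  have h : ∫ ω, (g ω (valueAt y₀ ω) + a ω (valueAt y ω) - a ω (valueAt y₀ ω)) ∂P ≤
      ∫ ω, g ω (valueAt y ω) ∂P := by
    refine integral_mono_ae (hadd.sub (hz y₀).1) (hint y) ?_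
    filter_upwards [hsub] with ω hω
    have := hω.1 (valueAt y ω)
    rw [map_sub] at this
    linarith
  rw [integral_sub hadd (hz y₀).1, integral_add (hint y₀) (hz y).1,
    ← (hz y).2, ← (hz y₀).2] at h
  linarith

end Minorant

/-! ### Distances to convex sets and automatic continuity -/

section Convexity

variable {E : Type*} [NormedAddCommGroup E] [NormedSpace ℝ E]

/-- The distance to a convex set is a convex function. -/
theorem infDist_combo_le {C : Set E} (hC : Convex ℝ C) (hne : C.Nonempty) (x y : E) {a b : ℝ}
    (ha : 0 ≤ a) (hb : 0 ≤ b) (hab : a + b = 1) :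
    Metric.infDist (a • x + b • y) C ≤ a * Metric.infDist x C + b * Metric.infDist y C := by
  refine le_of_forall_pos_le_add fun ε hε => ?_
  obtain ⟨u, hu, hxu⟩ := (Metric.infDist_lt_iff hne).1 (lt_add_of_pos_right (Metric.infDist x C) hε)
  obtain ⟨v, hv, hyv⟩ := (Metric.infDist_lt_iff hne).1 (lt_add_of_pos_right (Metric.infDist y C) hε)
  calc Metric.infDist (a • x + b • y) C
      ≤ dist (a • x + b • y) (a • u + b • v) :=
        Metric.infDist_le_dist_of_mem (hC hu hv ha hb hab)
    _ ≤ dist (a • x) (a • u) + dist (b • y) (b • v) := dist_add_add_le _ _ _ _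
    _ = a * dist x u + b * dist y v := by
        rw [dist_smul₀, dist_smul₀, Real.norm_of_nonneg ha, Real.norm_of_nonneg hb]
    _ ≤ a * (Metric.infDist x C + ε) + b * (Metric.infDist y C + ε) := by gcongr
    _ = a * Metric.infDist x C + b * Metric.infDist y C + ε := by
        linear_combination ε * hab

/-- Adding an element of a convex cone does not increase the distance to the cone. -/
theorem infDist_add_le_of_mem {K : Set E} (hK : Convex ℝ K)
    (hcone : ∀ c : ℝ, 0 < c → ∀ r ∈ K, c • r ∈ K) (z : E) {k : E} (hk : k ∈ K) :
    Metric.infDist (z + k) K ≤ Metric.infDist z K := by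
  refine le_of_forall_pos_le_add fun ε hε => ?_
  obtain ⟨u, hu, hzu⟩ := (Metric.infDist_lt_iff ⟨k, hk⟩).1
    (lt_add_of_pos_right (Metric.infDist z K) hε)
  have huk : u + k ∈ K := by
    -- A convex cone is closed under addition: `u + k` is twice the midpoint.
    have h := hcone 2 two_pos _ (hK hu hk (a := 1 / 2) (b := 1 / 2) (by norm_num) (by norm_num)
      (by norm_num))
    convert h using 1
    module
  refine (Metric.infDist_le_dist_of_mem huk).trans ?_
  rw [dist_add_right]
  exact hzu.le

/-- A finite convex lower semicontinuous function on a Banach space is continuous. -/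
theorem _root_.ConvexOn.continuous_of_lowerSemicontinuous [CompleteSpace E] {f : E → ℝ}
    (hf : ConvexOn ℝ univ f) (hl : LowerSemicontinuous f) : Continuous f := by
  rw [← continuousOn_univ]
  refine ((hf.continuousOn_tfae isOpen_univ univ_nonempty).out 1 3).2 ?_
  -- By Baire, one of the closed sublevel sets has interior; a convex function bounded above near
  -- one point is continuous.
  obtain ⟨n, x, hx⟩ := nonempty_interior_of_iUnion_of_closed (f := fun n : ℕ => f ⁻¹' Iic (n : ℝ))
    (fun n => lowerSemicontinuous_iff_isClosed_preimage.1 hl n)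
    (eq_univ_of_forall fun x => mem_iUnion.2 (exists_nat_ge (f x)))
  refine ⟨x, mem_univ x, n, ?_⟩
  rw [Filter.eventually_map]
  exact mem_interior_iff_mem_nhds.1 hx

end Convexity

/-! ### Carathéodory integrands and uniform null sets -/

section Measurability

variable {Ω E F : Type*} [MeasurableSpace Ω] {P : Measure Ω}

/-- A Carathéodory function composed with a strongly measurable function is measurable. -/
theorem aestronglyMeasurable_caratheodory [TopologicalSpace E]
    [TopologicalSpace F] [TopologicalSpace.PseudoMetrizableSpace F] {h : Ω → E → F}
    (hc : ∀ ω, Continuous (h ω)) (hm : ∀ x, AEStronglyMeasurable (fun ω => h ω x) P)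
    {p : Ω → E} (hp : AEStronglyMeasurable p P) :
    AEStronglyMeasurable (fun ω => h ω (p ω)) P := by
  obtain ⟨p', hp', hpp'⟩ := hp
  have hs : ∀ s : SimpleFunc Ω E, AEStronglyMeasurable (fun ω => h ω (s ω)) P := by
    intro s
    have hU : ⋃ y : s.range, s ⁻¹' {(y : E)} = univ :=
      eq_univ_of_forall fun ω => mem_iUnion.2 ⟨⟨s ω, s.mem_range_self ω⟩, rfl⟩
    rw [← Measure.restrict_univ (μ := P), ← hU, aestronglyMeasurable_iUnion_iff]
    refine fun y => ((hm y).mono_measure Measure.restrict_le_self).congr ?_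
    refine ae_restrict_of_forall_mem (s.measurableSet_fiber _) fun ω hω => ?_
    simp only [show s ω = y from hω]
  have h1 : AEStronglyMeasurable (fun ω => h ω (p' ω)) P :=
    aestronglyMeasurable_of_tendsto_ae Filter.atTop (fun n => hs (hp'.approx n))
      (ae_of_all _ fun ω => ((hc ω).tendsto _).comp (hp'.tendsto_approx ω))
  exact h1.congr (hpp'.mono fun ω hω => by simp only [hω])

theorem ae_norm_le_norm_Lp [NormedAddCommGroup E] (f : Lp E ∞ P) : ∀ᵐ ω ∂P, ‖f ω‖ ≤ ‖f‖ := by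
  filter_upwards [ae_le_eLpNormEssSup (f := (f : Ω → E)) (μ := P)] with ω hω
  rw [Lp.norm_def, eLpNorm_exponent_top]
  have hf : eLpNormEssSup (f : Ω → E) P ≠ ∞ := by
    rw [← eLpNorm_exponent_top]; exact Lp.eLpNorm_ne_top f
  simpa using ENNReal.toReal_mono hf hω

/-- Continuity makes the exceptional null set of a pointwise bound uniform. -/
theorem ae_forall_norm_le_of_forall_ae {X Y : Type*} [NormedAddCommGroup X]
    [TopologicalSpace.SeparableSpace X] [NormedAddCommGroup Y]
    [TopologicalSpace.SeparableSpace Y] [NormedAddCommGroup F] {h : X → Y → Ω → F}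
    (hc : ∀ ω, Continuous fun p : X × Y => h p.1 p.2 ω) {r b : ℝ}
    (hb : ∀ x y, ‖x‖ + ‖y‖ ≤ r → ∀ᵐ ω ∂P, ‖h x y ω‖ ≤ b) :
    ∀ᵐ ω ∂P, ∀ x y, ‖x‖ + ‖y‖ < r → ‖h x y ω‖ ≤ b := by
  let d := TopologicalSpace.denseSeq (X × Y)
  have hd : DenseRange d := TopologicalSpace.denseRange_denseSeq _
  have hall : ∀ᵐ ω ∂P, ∀ n, ‖(d n).1‖ + ‖(d n).2‖ ≤ r → ‖h (d n).1 (d n).2 ω‖ ≤ b := by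
    rw [ae_all_iff]
    intro n
    by_cases hn : ‖(d n).1‖ + ‖(d n).2‖ ≤ r
    · exact (hb _ _ hn).mono fun ω hω _ => hω
    · exact ae_of_all _ fun ω h => absurd h hn
  filter_upwards [hall] with ω hω x y hxy
  -- The strict inequality makes the region open, so the dense sequence is dense inside it.
  have hU : IsOpen {p : X × Y | ‖p.1‖ + ‖p.2‖ < r} := isOpen_lt (by fun_prop) continuous_const
  have hC : IsClosed {p : X × Y | ‖h p.1 p.2 ω‖ ≤ b} := isClosed_le (hc ω).norm continuous_const
  have hsub : {p : X × Y | ‖p.1‖ + ‖p.2‖ < r} ∩ range d ⊆ {p : X × Y | ‖h p.1 p.2 ω‖ ≤ b} := by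
    rintro _ ⟨hp, n, rfl⟩
    exact hω n (le_of_lt hp)
  exact hC.closure_subset_iff.2 hsub
    (hd.open_subset_closure_inter hU (show (x, y) ∈ _ from hxy))

end Measurability

/-! ### Pointwise values of decisions and perturbations -/

section ValueAt

variable {Ω X₁ X₂ W R : Type*} [MeasurableSpace Ω] {P : Measure Ω} [NormedAddCommGroup X₁]
  [NormedAddCommGroup X₂] [NormedAddCommGroup W] [NormedAddCommGroup R]

theorem aestronglyMeasurable_valueAt (y : (X₁ × Lp X₂ ∞ P) × (Lp W ∞ P × Lp R ∞ P)) :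
    AEStronglyMeasurable (valueAt y) P :=
  aestronglyMeasurable_const.prodMk ((Lp.aestronglyMeasurable _).prodMk
    ((Lp.aestronglyMeasurable _).prodMk (Lp.aestronglyMeasurable _)))

theorem ae_norm_valueAt_le (y : (X₁ × Lp X₂ ∞ P) × (Lp W ∞ P × Lp R ∞ P)) :
    ∀ᵐ ω ∂P, ‖valueAt y ω‖ ≤ ‖y‖ := by
  filter_upwards [ae_norm_le_norm_Lp y.1.2, ae_norm_le_norm_Lp y.2.1, ae_norm_le_norm_Lp y.2.2]
    with ω h2 h3 h4
  simp only [valueAt, norm_prod_le_iff]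
  exact ⟨(norm_fst_le _).trans (norm_fst_le _),
    h2.trans ((norm_snd_le _).trans (norm_fst_le _)),
    h3.trans ((norm_fst_le _).trans (norm_snd_le _)),
    h4.trans ((norm_snd_le _).trans (norm_snd_le _))⟩

end ValueAt

/-! ### The constraint violation and the objective -/

namespace Problem

variable {Ω X₁ X₂ W R : Type*} [NormedAddCommGroup X₁] [NormedAddCommGroup X₂]
  [NormedAddCommGroup W] [NormedAddCommGroup R] (D : Problem Ω X₁ X₂ W R)

/-- The violation of the constraints at `ω`. -/
def violation (ω : Ω) (q : X₁ × X₂ × W × R) : ℝ :=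
  Metric.infDist q.1 D.C₁ + Metric.infDist q.2.1 D.C₂ + ‖D.e q.1 q.2.1 ω - q.2.2.1‖ +
    Metric.infDist (q.2.2.2 - D.i q.1 q.2.1 ω) D.K

theorem violation_nonneg (ω : Ω) (q : X₁ × X₂ × W × R) : 0 ≤ D.violation ω q :=
  add_nonneg (add_nonneg (add_nonneg Metric.infDist_nonneg Metric.infDist_nonneg)
    (norm_nonneg _)) Metric.infDist_nonneg

namespace Assumptions

variable [MeasurableSpace Ω] {P : Measure Ω} [NormedSpace ℝ X₁] [NormedSpace ℝ X₂]
  [NormedSpace ℝ W] [NormedSpace ℝ R] {D} (hD : D.Assumptions P)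
include hD

theorem violation_eq_zero_iff (ω : Ω) (q : X₁ × X₂ × W × R) :
    D.violation ω q = 0 ↔ q.1 ∈ D.C₁ ∧ q.2.1 ∈ D.C₂ ∧ D.e q.1 q.2.1 ω = q.2.2.1 ∧
      D.leK (D.i q.1 q.2.1 ω) q.2.2.2 := by
  have h1 := Metric.infDist_nonneg (x := q.1) (s := D.C₁)
  have h2 := Metric.infDist_nonneg (x := q.2.1) (s := D.C₂)
  have h3 := norm_nonneg (D.e q.1 q.2.1 ω - q.2.2.1)
  have h4 := Metric.infDist_nonneg (x := q.2.2.2 - D.i q.1 q.2.1 ω) (s := D.K)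
  rw [hD.C₁_closed.mem_iff_infDist_zero hD.C₁_nonempty,
    hD.C₂_closed.mem_iff_infDist_zero hD.C₂_nonempty, ← sub_eq_zero (a := D.e _ _ _),
    ← norm_eq_zero (a := D.e _ _ _ - _), leK,
    hD.K_closed.mem_iff_infDist_zero hD.K_nonempty, violation]
  constructor
  · intro h
    refine ⟨?_, ?_, ?_, ?_⟩ <;> linarith
  · rintro ⟨h1, h2, h3, h4⟩
    rw [h1, h2, h3, h4]
    norm_num

theorem convexOn_violation (ω : Ω) : ConvexOn ℝ univ (D.violation ω) := by
  refine ⟨convex_univ, fun p _ q _ a b ha hb hab => ?_⟩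
  have h1 := infDist_combo_le hD.C₁_convex hD.C₁_nonempty p.1 q.1 ha hb hab
  have h2 := infDist_combo_le hD.C₂_convex hD.C₂_nonempty p.2.1 q.2.1 ha hb hab
  have h3 : ‖D.e (a • p.1 + b • q.1) (a • p.2.1 + b • q.2.1) ω - (a • p.2.2.1 + b • q.2.2.1)‖ ≤
      a * ‖D.e p.1 p.2.1 ω - p.2.2.1‖ + b * ‖D.e q.1 q.2.1 ω - q.2.2.1‖ := by
    have hlin := hD.e_linear ω
    have h := hlin.map_add (a • (p.1, p.2.1)) (b • (q.1, q.2.1))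
    rw [hlin.map_smul, hlin.map_smul] at h
    simp only [Prod.smul_mk, Prod.mk_add_mk] at h
    rw [h, ← Real.norm_of_nonneg ha, ← Real.norm_of_nonneg hb, ← norm_smul, ← norm_smul,
      Real.norm_of_nonneg ha, Real.norm_of_nonneg hb]
    refine le_trans (le_of_eq ?_) (norm_add_le _ _)
    congr 1
    module
  have h4 : Metric.infDist (a • p.2.2.2 + b • q.2.2.2 -
        D.i (a • p.1 + b • q.1) (a • p.2.1 + b • q.2.1) ω) D.K ≤
      a * Metric.infDist (p.2.2.2 - D.i p.1 p.2.1 ω) D.K +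
        b * Metric.infDist (q.2.2.2 - D.i q.1 q.2.1 ω) D.K := by
    -- The `K`-convexity of `i` is available only for weights strictly inside the unit interval.
    rcases eq_or_lt_of_le ha with rfl | ha'
    · obtain rfl : b = 1 := by linarith
      simp
    rcases eq_or_lt_of_le hb with rfl | hb'
    · obtain rfl : a = 1 := by linarith
      simp
    obtain rfl : b = 1 - a := by linarith
    have hk := hD.i_convex ω (p.1, p.2.1) (q.1, q.2.1) a ha' (by linarith)
    have h := infDist_add_le_of_mem hD.K_convex hD.K_cone
      (a • (p.2.2.2 - D.i p.1 p.2.1 ω) + (1 - a) • (q.2.2.2 - D.i q.1 q.2.1 ω)) hk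
    refine le_trans (le_of_eq ?_)
      (h.trans (infDist_combo_le hD.K_convex hD.K_nonempty _ _ ha hb hab))
    congr 1
    module
  simp only [violation, Prod.fst_add, Prod.snd_add, Prod.smul_fst, Prod.smul_snd, smul_eq_mul]
  linarith

theorem continuous_violation (ω : Ω) : Continuous (D.violation ω) := by
  have he : Continuous fun q : X₁ × X₂ × W × R => D.e q.1 q.2.1 ω :=
    (hD.e_continuous ω).comp (by fun_prop : Continuous fun q : X₁ × X₂ × W × R => (q.1, q.2.1))
  have hi : Continuous fun q : X₁ × X₂ × W × R => D.i q.1 q.2.1 ω :=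
    (hD.i_continuous ω).comp (by fun_prop : Continuous fun q : X₁ × X₂ × W × R => (q.1, q.2.1))
  have h1 := Metric.continuous_infDist_pt D.C₁
  have h2 := Metric.continuous_infDist_pt D.C₂
  have h3 := Metric.continuous_infDist_pt D.K
  unfold violation
  fun_prop

theorem aestronglyMeasurable_violation {p : Ω → X₁ × X₂ × W × R}
    (hp : AEStronglyMeasurable p P) :
    AEStronglyMeasurable (fun ω => D.violation ω (p ω)) P := by
  refine aestronglyMeasurable_caratheodory hD.continuous_violation (fun q => ?_) hp
  refine (aestronglyMeasurable_const.add
    ((hD.e_measurable _ _).sub aestronglyMeasurable_const).norm).add ?_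
  exact (Metric.continuous_infDist_pt D.K).comp_aestronglyMeasurable
    (aestronglyMeasurable_const.sub (hD.i_measurable _ _))

theorem exists_violation_le [TopologicalSpace.SeparableSpace X₁]
    [TopologicalSpace.SeparableSpace X₂] {r : ℝ} (hr : 0 ≤ r) :
    ∃ B, ∀ᵐ ω ∂P, ∀ q, ‖q‖ ≤ r → D.violation ω q ≤ B := by
  -- Two components of norm at most `r` have norm sum at most `2 * r`; the extra `1` supplies the
  -- strict inequality needed for a uniform null set.
  obtain ⟨be, -, hbe⟩ := hD.e_bound (2 * r + 1) (by positivity)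
  obtain ⟨bi, -, hbi⟩ := hD.i_bound (2 * r + 1) (by positivity)
  refine ⟨(Metric.infDist 0 D.C₁ + r) + (Metric.infDist 0 D.C₂ + r) + (be + r) +
    (Metric.infDist 0 D.K + (r + bi)), ?_⟩
  filter_upwards [ae_forall_norm_le_of_forall_ae hD.e_continuous hbe,
    ae_forall_norm_le_of_forall_ae hD.i_continuous hbi] with ω he hi q hq
  simp only [norm_prod_le_iff] at hq
  obtain ⟨h1, h2, h3, h4⟩ := hq
  have hlt : ‖q.1‖ + ‖q.2.1‖ < 2 * r + 1 := by linarith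
  have k1 := Metric.infDist_le_infDist_add_dist (x := q.1) (y := 0) (s := D.C₁)
  have k2 := Metric.infDist_le_infDist_add_dist (x := q.2.1) (y := 0) (s := D.C₂)
  have k3 := (norm_sub_le (D.e q.1 q.2.1 ω) q.2.2.1).trans (add_le_add (he _ _ hlt) h3)
  have k4 := Metric.infDist_le_infDist_add_dist (x := q.2.2.2 - D.i q.1 q.2.1 ω) (y := 0) (s := D.K)
  have k5 := (norm_sub_le q.2.2.2 (D.i q.1 q.2.1 ω)).trans (add_le_add h4 (hi _ _ hlt))
  rw [dist_zero_right] at k1 k2 k4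
  unfold violation
  linarith

theorem integrable_violation [IsProbabilityMeasure P] [TopologicalSpace.SeparableSpace X₁]
    [TopologicalSpace.SeparableSpace X₂] (y : (X₁ × Lp X₂ ∞ P) × (Lp W ∞ P × Lp R ∞ P)) :
    Integrable (fun ω => D.violation ω (valueAt y ω)) P := by
  obtain ⟨B, hB⟩ := hD.exists_violation_le (norm_nonneg y)
  refine Integrable.of_bound (hD.aestronglyMeasurable_violation (aestronglyMeasurable_valueAt y)) B ?_
  filter_upwards [hB, ae_norm_valueAt_le y] with ω h1 h2
  rw [Real.norm_of_nonneg (D.violation_nonneg _ _)]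
  exact h1 _ h2

theorem feasible_iff_integral_violation [IsProbabilityMeasure P]
    [TopologicalSpace.SeparableSpace X₁] [TopologicalSpace.SeparableSpace X₂]
    (y : (X₁ × Lp X₂ ∞ P) × (Lp W ∞ P × Lp R ∞ P)) :
    D.Feasible P y.1 y.2 ↔ ∫ ω, D.violation ω (valueAt y ω) ∂P = 0 := by
  rw [integral_eq_zero_iff_of_nonneg (fun ω => D.violation_nonneg _ _) (hD.integrable_violation y)]
  have h : (fun ω => D.violation ω (valueAt y ω)) =ᵐ[P] 0 ↔ ∀ᵐ ω ∂P, y.1.1 ∈ D.C₁ ∧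
      y.1.2 ω ∈ D.C₂ ∧ D.e y.1.1 (y.1.2 ω) ω = y.2.1 ω ∧
        D.leK (D.i y.1.1 (y.1.2 ω) ω) (y.2.2 ω) :=
    Filter.eventually_congr (ae_of_all _ fun ω => hD.violation_eq_zero_iff ω (valueAt y ω))
  rw [h, Filter.eventually_and, Filter.eventually_and, Filter.eventually_and,
    Filter.eventually_const, Feasible]

/-- Infeasible points have a weak-star neighbourhood of infeasible points. -/
theorem exists_pairing_of_not_feasible [IsProbabilityMeasure P]
    [TopologicalSpace.SeparableSpace X₁]
    [TopologicalSpace.SeparableSpace X₂] (hX₂ : IsReflexive X₂)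
    [TopologicalSpace.SeparableSpace W] (hW : IsReflexive W)
    [TopologicalSpace.SeparableSpace R] (hR : IsReflexive R)
    {y₀ : (X₁ × Lp X₂ ∞ P) × (Lp W ∞ P × Lp R ∞ P)} (hy₀ : ¬ D.Feasible P y₀.1 y₀.2) :
    ∃ z, ∃ c : ℝ, 0 < pairing X₁ X₂ W R P y₀ z + c ∧
      ∀ y, D.Feasible P y.1 y.2 → pairing X₁ X₂ W R P y z + c ≤ 0 := by
  obtain ⟨B, hB⟩ := hD.exists_violation_le (r := ‖y₀‖ + 1) (by positivity)
  obtain ⟨z, c, h0, hle⟩ := exists_affine_minorant hX₂ hW hR hD.convexOn_violation y₀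
    (fun d => (hD.aestronglyMeasurable_violation
      ((aestronglyMeasurable_valueAt y₀).add aestronglyMeasurable_const)).aemeasurable)
    (M := B) one_pos (by
      filter_upwards [hB, ae_norm_valueAt_le y₀] with ω h1 h2 d hd
      have h3 := h1 _ ((norm_add_le (valueAt y₀ ω) d).trans (add_le_add h2 hd))
      linarith [D.violation_nonneg ω (valueAt y₀ ω)])
    hD.integrable_violation
  refine ⟨z, c, ?_, fun y hy => ?_⟩
  · rw [h0]
    exact lt_of_le_of_ne (integral_nonneg fun ω => D.violation_nonneg _ _) fun h =>
      hy₀ ((hD.feasible_iff_integral_violation y₀).2 h.symm)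
  · exact (hle y).trans ((hD.feasible_iff_integral_violation y).1 hy).le

theorem integral_objective [IsProbabilityMeasure P] (x : X₁ × Lp X₂ ∞ P) :
    ∫ ω, (D.J₁ x.1 + D.J₂ x.1 (x.2 ω)) ∂P = D.j P x := by
  rw [integral_add (integrable_const _) (hD.integrable_J₂ x)]
  simp [j]

/-- The objective has an exact weak-star continuous affine minorant at every point. -/
theorem exists_pairing_le_objective [IsProbabilityMeasure P]
    [CompleteSpace X₁] [TopologicalSpace.SeparableSpace X₁]
    [CompleteSpace X₂] [TopologicalSpace.SeparableSpace X₂] (hX₂ : IsReflexive X₂)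
    [TopologicalSpace.SeparableSpace W] (hW : IsReflexive W)
    [TopologicalSpace.SeparableSpace R] (hR : IsReflexive R)
    (y₀ : (X₁ × Lp X₂ ∞ P) × (Lp W ∞ P × Lp R ∞ P)) :
    ∃ z, ∃ c : ℝ, pairing X₁ X₂ W R P y₀ z + c = D.j P y₀.1 ∧
      ∀ y, pairing X₁ X₂ W R P y z + c ≤ D.j P y.1 := by
  have hJ := hD.J_convex.continuous_of_lowerSemicontinuous hD.J_lsc
  have hc : Continuous fun q : X₁ × X₂ × W × R => D.J₁ q.1 + D.J₂ q.1 q.2.1 :=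
    hJ.comp (by fun_prop : Continuous fun q : X₁ × X₂ × W × R => (q.1, q.2.1))
  have hconv : ConvexOn ℝ univ fun q : X₁ × X₂ × W × R => D.J₁ q.1 + D.J₂ q.1 q.2.1 := by
    refine ⟨convex_univ, fun p _ q _ a b ha hb hab => ?_⟩
    exact hD.J_convex.2 (mem_univ (p.1, p.2.1)) (mem_univ (q.1, q.2.1)) ha hb hab
  have hc₀ : Continuous fun v : X₁ => D.J₁ v + D.J₂ v 0 :=
    hJ.comp (by fun_prop : Continuous fun v : X₁ => (v, (0 : X₂)))
  -- Only `J₂` is assumed bounded on bounded sets, so `J₁` is controlled near `y₀.1.1` through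
  -- continuity of `v ↦ J(v, 0)`. One `δ` serves every `ω` because the first component is constant.
  obtain ⟨δ, hδ, hδ'⟩ := Metric.eventually_nhds_iff_ball.1
    ((hc₀.tendsto y₀.1.1).eventually_lt_const (lt_add_one _))
  obtain ⟨A, -, hA⟩ := hD.J₂_bound (2 * (‖y₀‖ + δ) + 1) (by positivity)
  -- Three bounds on `J₂` cost `3 * A`: replacing second argument `0` by the actual one, and
  -- discarding `J₂` at the base point. The fourth `A` is slack.
  set N : ℝ := D.J₁ y₀.1.1 + D.J₂ y₀.1.1 0 + 1 + 4 * A - D.J₁ y₀.1.1 with hN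
  obtain ⟨z, c, h0, hle⟩ := exists_affine_minorant hX₂ hW hR (P := P)
    (g := fun _ q => D.J₁ q.1 + D.J₂ q.1 q.2.1) (fun _ => hconv) y₀
    (fun d => (hc.comp_aestronglyMeasurable
      ((aestronglyMeasurable_valueAt y₀).add aestronglyMeasurable_const)).aemeasurable)
    (M := N) (half_pos hδ) (by
      filter_upwards [ae_norm_valueAt_le y₀] with ω h1 d hd
      have h2 : ‖valueAt y₀ ω + d‖ ≤ ‖y₀‖ + δ :=
        (norm_add_le _ _).trans (add_le_add h1 (hd.trans (by linarith)))
      have h3 := h1.trans (le_add_of_nonneg_right hδ.le)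
      have h4 := hδ' (y₀.1.1 + d.1) (by
        rw [mem_ball_iff_norm, add_sub_cancel_left]
        exact ((norm_fst_le d).trans hd).trans_lt (half_lt_self hδ))
      simp only [norm_prod_le_iff] at h2 h3
      have k1 := abs_le.1 (hA _ _ (by linarith [h2.1, h2.2.1] :
        ‖(valueAt y₀ ω + d).1‖ + ‖(valueAt y₀ ω + d).2.1‖ ≤ _))
      have k2 := abs_le.1 (hA (valueAt y₀ ω + d).1 0 (by
        rw [norm_zero]; linarith [h2.1, norm_nonneg (valueAt y₀ ω + d).1]))
      have k3 := abs_le.1 (hA _ _ (by linarith [h3.1, h3.2.1] :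
        ‖(valueAt y₀ ω).1‖ + ‖(valueAt y₀ ω).2.1‖ ≤ _))
      change D.J₁ (valueAt y₀ ω + d).1 + D.J₂ (valueAt y₀ ω + d).1 0 < _ at h4
      change _ - (D.J₁ y₀.1.1 + D.J₂ (valueAt y₀ ω).1 (valueAt y₀ ω).2.1) ≤ N
      linarith)
    (fun y => (integrable_const (D.J₁ y.1.1)).add (hD.integrable_J₂ y.1))
  exact ⟨z, c, h0.trans (hD.integral_objective y₀.1), fun y =>
    (hle y).trans_eq (hD.integral_objective y.1)⟩

end Assumptions

end Problem

end TwoStage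

end

/-! ### Lower semicontinuity of the perturbation function -/

theorem mainTheorem8
    {Ω X₁ X₂ W R : Type*} [MeasurableSpace Ω] (P : MeasureTheory.Measure Ω)
    [MeasureTheory.IsProbabilityMeasure P]
    [NormedAddCommGroup X₁] [NormedSpace ℝ X₁] [CompleteSpace X₁]
    [TopologicalSpace.SeparableSpace X₁] (hX₁ : TwoStage.IsReflexive X₁)
    [NormedAddCommGroup X₂] [NormedSpace ℝ X₂] [CompleteSpace X₂]
    [TopologicalSpace.SeparableSpace X₂] (hX₂ : TwoStage.IsReflexive X₂)
    [NormedAddCommGroup W] [NormedSpace ℝ W] [CompleteSpace W]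
    [TopologicalSpace.SeparableSpace W] (hW : TwoStage.IsReflexive W)
    [NormedAddCommGroup R] [NormedSpace ℝ R] [CompleteSpace R]
    [TopologicalSpace.SeparableSpace R] (hR : TwoStage.IsReflexive R)
    (D : TwoStage.Problem Ω X₁ X₂ W R) (hD : D.Assumptions P) :
    LowerSemicontinuous
      (fun y : TwoStage.WeakStarSpace X₁ X₂ W R P => D.phi P y) := by
  have hcont : ∀ z (c : ℝ), Continuous fun y : TwoStage.WeakStarSpace X₁ X₂ W R P =>
      TwoStage.pairing X₁ X₂ W R P y z + c := fun z c =>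
    (WeakBilin.eval_continuous (TwoStage.pairing X₁ X₂ W R P) z).add_const c
  intro y₀ t ht
  by_cases hf : D.Feasible P y₀.1 y₀.2
  · obtain ⟨z, c, h0, hle⟩ := hD.exists_pairing_le_objective hX₂ hW hR y₀
    have hphi : ∀ y, ((TwoStage.pairing X₁ X₂ W R P y z + c : ℝ) : WithTop ℝ) ≤ D.phi P y := by
      intro y
      unfold TwoStage.Problem.phi
      split_ifs
      · exact WithTop.coe_le_coe.2 (hle y)
      · exact le_top
    obtain ⟨r, rfl⟩ := WithTop.ne_top_iff_exists.1 (ne_top_of_lt ht)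
    have hr : r < TwoStage.pairing X₁ X₂ W R P y₀ z + c := by
      rw [h0]
      simpa [TwoStage.Problem.phi, hf] using ht
    filter_upwards [(hcont z c).continuousAt.eventually_const_lt hr] with y hy
    exact (WithTop.coe_lt_coe.2 hy).trans_le (hphi y)
  · obtain ⟨z, c, h0, hle⟩ := hD.exists_pairing_of_not_feasible hX₂ hW hR hf
    filter_upwards [(hcont z c).continuousAt.eventually_const_lt h0] with y hy
    have hy' : ¬ D.Feasible P y.1 y.2 := fun h => (hle y h).not_gt hy
    simp only [TwoStage.Problem.phi, if_neg hy']
    exact lt_top_of_lt ht
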